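/- Consider a slotted downlink with one base station and $N\ge 1$ users. Let $\mathcal S\subset[0,\infty)$ be a finite set of channel states (rates). For every user $i$ a joint law of a pair $(C_i,\widehat C_i)\in\mathcal S\times\mathcal S$ (channel state and its estimate) is given; the pairs are independent across users and i.i.d. across time slots. In slot $t$ a user $I[t]\in\{1,\dots,N\}$ and a rate $R[t]\in\mathcal S$ are chosen, and the queue lengths, with values in $[0,\infty)$, evolve by $$Q_i[t+1]=\big[Q_i[t]-\mathbf 1(I[t]=i)\,R[t]\,\mathbf 1(R[t]\le C_i[t])\big]^+ + A_i[t].$$ The arrival vectors $(A_1[t],\dots,A_N[t])\in[0,\infty)^N$ are i.i.d. across slots, independent of the channels, estimates and decisions of the current and earlier slots and of the initial queue lengths, with finite means $E[A_i[t]]=\lambda_i$. A stationary policy is a (possibly randomized) rule that chooses $(I[t],R[t])$ according to a probability distribution that depends (measurably) only on the current queue lengths $Q[t]$ and estimates $\widehat C[t]$; the rule may be designed with full knowledge of the joint laws of $(C_i,\widehat C_i)$. Given $Q[t]$ and $\widehat C[t]$, the decision is independent of the channel states $C[t]$. Queue $i$ is stable if there is a probability distribution with distribution function $F_i$ such that $\lim_{t\to\infty}P(Q_i[t]\le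 q)=F_i(q)$ for all $q$. A policy supports a rate vector $\lambda\in[0,\infty)^N$ if all queues are stable for every arrival law with mean $\lambda$ and every initial distribution. The network stability region is the closure of the set of rate vectors that are supported by some stationary policy. For all $i$ and $\hat c\in\mathcal S$ let $r_i^*(\hat c)\in\mathcal S$ be a maximizer over $r\in\mathcal S$ of $P(C_i\ge r\mid\widehat C_i=\hat c)\, r$ (any maximizer; any element of $\mathcal S$ if $P(\widehat C_i=\hat c)=0$), and let $$\Lambda=\sum_{\hat c\in\mathcal S^N}\Big(\prod_{i=1}^N P(\widehat C_i=\hat c_i)\Big)\cdot\mathcal{CH}\Big[\,0,\;P\big(C_i\ge r_i^*(\hat c_i)\mid\widehat C_i=\hat c_i\big)\,r_i^*(\hat c_i)\,e_i;\ i=1,\dots,N\Big],$$ where $\mathcal{CH}$ is the convex hull, $e_i$ the $i$-th coordinate vector, and the sum is the Minkowski sum. Then: (a) The network stability region equals $\Lambda$. (b) Every $\lambda$ in the interior of $\Lambda$ is supported by some stationary policy; moreover, for every arrival law with mean $\lambda$, the queue-length Markov chain under this policy has a stationary distribution whose marginals are the limits of the laws of the $Q_i[t]$, for every initial distribution. (c)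 If $\lambda\notin\Lambda$, then for every stationary policy, every arrival law with mean $\lambda$ and every initial distribution, at least one queue is not stable. -/

import Mathlib

open MeasureTheory ProbabilityTheory Filter Topology
open scoped NNReal Pointwise

noncomputable section

namespace Downlink

variable {N : ℕ} {S : Finset ℝ≥0}

/-- Channel/estimator joint statistics: `P i` is the joint law of the pair `(C_i, Ĉ_i)`
(first coordinate: the channel state, second coordinate: its estimate). -/
abbrev JointStatistics (N : ℕ) (S : Finset ℝ≥0) : Type := Fin N → PMF (S × S)

/-- The joint law, in one slot, of all pairs `(C_i, Ĉ_i)`: independent across users. -/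
def channelLaw (P : JointStatistics N S) : Measure (Fin N → S × S) :=
  Measure.pi fun i => (P i).toMeasure

instance (P : JointStatistics N S) : IsProbabilityMeasure (channelLaw P) := by
  unfold channelLaw; infer_instance

/-- The vector of estimates contained in the vector of pairs `(C_i, Ĉ_i)`. -/
def estimates (x : Fin N → S × S) : Fin N → S := fun i => (x i).2

/-- `P(Ĉ = ĉ) = ∏ i, P(Ĉ_i = ĉ_i)`. -/
def estimateProb (P : JointStatistics N S) (chat : Fin N → S) : ℝ :=
  ∏ i, (P i).toMeasure.real {x | x.2 = chat i}

/-- The conditional probability `P(C_i ≥ r | Ĉ_i = ĉ)`. -/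
def successProb (P : JointStatistics N S) (i : Fin N) (chat r : S) : ℝ :=
  (ProbabilityTheory.cond (P i).toMeasure {x | x.2 = chat}).real {x | r ≤ x.1}

/-- `P(C_i ≥ r | Ĉ_i = ĉ) · r`. -/
def expectedRate (P : JointStatistics N S) (i : Fin N) (chat r : S) : ℝ :=
  successProb P i chat r * ((r : ℝ≥0) : ℝ)

/-- `rstar i ĉ` is a maximizer over `r ∈ S` of `P(C_i ≥ r | Ĉ_i = ĉ) · r`. -/
def IsOptimalRate (P : JointStatistics N S) (rstar : Fin N → S → S) : Prop :=
  ∀ i chat r, expectedRate P i chat r ≤ expectedRate P i chat (rstar i chat)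

/-- The set `Λ`: a weighted Minkowski sum, over all estimate vectors, of convex hulls. -/
def rateRegion (P : JointStatistics N S) (rstar : Fin N → S → S) : Set (Fin N → ℝ) :=
  ∑ chat : Fin N → S, estimateProb P chat •
    convexHull ℝ (insert 0 (Set.range fun i : Fin N =>
      expectedRate P i (chat i) (rstar i (chat i)) • (Pi.single i 1 : Fin N → ℝ)))

/-- A (randomized) stationary scheduling policy: given the current queue lengths and the current
channel estimates, a probability distribution for the pair (scheduled user, rate in `S`). -/
structure StationaryPolicy (N : ℕ) (S : Finset ℝ≥0) where
  /-- the conditional law of the decision `(I[t], R[t])` given `(Q[t], Ĉ[t])` -/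
  kernel : Kernel ((Fin N → ℝ≥0) × (Fin N → S)) (Fin N × S)
  isMarkov : IsMarkovKernel kernel

instance (φ : StationaryPolicy N S) : IsMarkovKernel φ.kernel := φ.isMarkov

/-- The queue recursion `Q_i ↦ [Q_i - 1(I = i) R 1(R ≤ C_i)]⁺ + A_i`; the subtraction of `ℝ≥0`
is truncated at `0`. The argument is `(Q, (((C, Ĉ), (I, R)), A))`. -/
def nextQueue (p : (Fin N → ℝ≥0) × (((Fin N → S × S) × (Fin N × S)) × (Fin N → ℝ≥0))) :
    Fin N → ℝ≥0 :=
  let q := p.1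
  let c : Fin N → S := fun i => (p.2.1.1 i).1
  let I := p.2.1.2.1
  let r := p.2.1.2.2
  let a := p.2.2
  fun i => (q i - if I = i ∧ r ≤ c i then (r : ℝ≥0) else 0) + a i

/-- One slot of randomness given the queue lengths: the channel/estimate pairs are drawn, then the
decision from the queue lengths and the estimates. -/
def decisionKernel (P : JointStatistics N S) (φ : StationaryPolicy N S) :
    Kernel (Fin N → ℝ≥0) ((Fin N → S × S) × (Fin N × S)) :=
  Kernel.const (Fin N → ℝ≥0) (channelLaw P) ⊗ₖ
    φ.kernel.comap (fun p : (Fin N → ℝ≥0) × (Fin N → S × S) => (p.1, estimates p.2))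
      (by unfold estimates; fun_prop)

/-- Transition kernel of the queue-length Markov chain, where the arrival vector of a slot has
law `ν` and is independent of everything else. -/
def queueKernel (P : JointStatistics N S) (φ : StationaryPolicy N S)
    (ν : Measure (Fin N → ℝ≥0)) : Kernel (Fin N → ℝ≥0) (Fin N → ℝ≥0) :=
  (Kernel.id ×ₖ (decisionKernel P φ ×ₖ Kernel.const (Fin N → ℝ≥0) ν)).map nextQueue

/-- The law of `Q[t]` when `Q[0]` has law `μ₀`. -/
def queueLaw (P : JointStatistics N S) (φ : StationaryPolicy N S)
    (ν μ₀ : Measure (Fin N → ℝ≥0)) : ℕ → Measure (Fin N → ℝ≥0)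
  | 0 => μ₀
  | t + 1 => (queueLaw P φ ν μ₀ t).bind (queueKernel P φ ν)

/-- `ν` is the law of a vector of arrivals with finite means `E[A_i] = lam i`. -/
structure IsArrivalLaw (ν : Measure (Fin N → ℝ≥0)) (lam : Fin N → ℝ) : Prop where
  isProb : IsProbabilityMeasure ν
  integrable : ∀ i, Integrable (fun a => ((a i : ℝ≥0) : ℝ)) ν
  mean : ∀ i, ∫ a, ((a i : ℝ≥0) : ℝ) ∂ν = lam i

/-- Stability of queue `i`, when `μ t` is the law of the queue-length vector at time `t`:
`P(Q_i[t] ≤ q) → F_i(q)` for all `q`, where `F_i` is a probability distribution. -/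
def QueueStable (μ : ℕ → Measure (Fin N → ℝ≥0)) (i : Fin N) : Prop :=
  ∃ F : Measure ℝ≥0, IsProbabilityMeasure F ∧
    ∀ q : ℝ≥0, Tendsto (fun t => (μ t).real {x | x i ≤ q}) atTop (𝓝 (F.real (Set.Iic q)))

/-- The policy `φ` supports the rate vector `lam`: all queues are stable, for all arrival laws
with this rate vector and all initial distributions. -/
def Supports (P : JointStatistics N S) (φ : StationaryPolicy N S) (lam : Fin N → ℝ) : Prop :=
  ∀ ν μ₀ : Measure (Fin N → ℝ≥0), IsArrivalLaw ν lam → IsProbabilityMeasure μ₀ →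
    ∀ i, QueueStable (queueLaw P φ ν μ₀) i

/-- The network stability region: the closure of the set of the (nonnegative) arrival rate vectors
that are supported by some stationary policy. -/
def stabilityRegion (P : JointStatistics N S) : Set (Fin N → ℝ) :=
  closure {lam | 0 ≤ lam ∧ ∃ φ : StationaryPolicy N S, Supports P φ lam}

theorem measurable_nextQueue : Measurable (nextQueue (N := N) (S := S)) := by
  unfold nextQueue
  refine measurable_pi_lambda _ fun i => ?_
  refine Measurable.add (Measurable.sub (by fun_prop) ?_) (by fun_prop)
  have h : Measurable (fun y : (Fin N → S × S) × (Fin N × S) =>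
      if y.2.1 = i ∧ y.2.2 ≤ (y.1 i).1 then (y.2.2 : ℝ≥0) else 0) := measurable_of_finite _
  exact h.comp (measurable_fst.comp measurable_snd)

instance (P : JointStatistics N S) (φ : StationaryPolicy N S) :
    IsMarkovKernel (decisionKernel P φ) := by
  unfold decisionKernel; infer_instance

instance (P : JointStatistics N S) (φ : StationaryPolicy N S) (ν : Measure (Fin N → ℝ≥0))
    [IsProbabilityMeasure ν] : IsMarkovKernel (queueKernel P φ ν) := by
  unfold queueKernel; exact Kernel.IsMarkovKernel.map _ measurable_nextQueue

end Downlink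

end

/-! Necessity. Given the queue lengths and the estimates, user `i` is served on average at most
(probability of scheduling `i`) times the best expected rate. So the mean service vector of a slot
lies below a point of Λ, hence in Λ, which is closed under decreasing nonnegative coordinates; being
convex and closed, Λ also contains averages over queue lengths and slots. Queue lengths need not
have finite means, so the drift is taken of `min Q_i (2K)`: it is at least `P(Q_i ≤ K) E[min A_i K]`
minus the mean service (`lintegral_truncated_le`). Stability makes the first term exceed `λ_i - ε/2`
for large `K` and `t`. The truncated length is bounded, so time-averaged mean service reaches `λ_i -
ε`; closedness of Λ gives `λ ∈ Λ`.

Sufficiency. Weights representing a point of Λ are scheduling probabilities given the estimates;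
they define a policy that ignores the queues and whose mean service dominates that point. Slots are
then i.i.d. and every queue is a Lindley recursion. Reversing time, as Loynes did, gives iterates
with the same law at each `t`. Started empty they increase with `t`, and if the net input drifts to
`-∞` they stay bounded and forget the initial content. Their limit solves the recursion, so its law
is invariant. This needs neither irreducibility nor a Lyapunov function.

An interior point has slack in every coordinate. Any other point of Λ is approximated by its
multiples `θ • λ`, `θ < 1`. -/

noncomputable section

namespace Downlink

/-! ### Pathwise study of the scalar queue recursion -/

/-- Backward iterates of the maps `x ↦ (x - σ n)⁺ + α n`: the map of index `t - 1` is applied first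
and the map of index `0` last. -/
def lindley : ℕ → ℝ≥0 → (ℕ → ℝ≥0) → (ℕ → ℝ≥0) → ℝ≥0
  | 0, x, _, _ => x
  | t + 1, x, σ, α => lindley t x (fun n => σ (n + 1)) (fun n => α (n + 1)) - σ 0 + α 0

/-- The limit of the backward iterates started at `0`. -/
def loynes (σ α : ℕ → ℝ≥0) : ℝ≥0 := ⨆ t, lindley t 0 σ α

/-- The partial sums of the net input. -/
def netInput (σ α : ℕ → ℝ≥0) (t : ℕ) : ℝ := ∑ n ∈ Finset.range t, ((α n : ℝ) - σ n)

theorem netInput_succ' (σ α : ℕ → ℝ≥0) (t : ℕ) :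
    netInput σ α (t + 1) =
      netInput (fun n => σ (n + 1)) (fun n => α (n + 1)) t + ((α 0 : ℝ) - σ 0) :=
  Finset.sum_range_succ' _ _

/-- A run from `x` that is never truncated ends at `x` plus the net input. If it is truncated, so is
the run from `0` in the same slot, and the two agree from then on. -/
theorem coe_lindley_eq_max (t : ℕ) (x : ℝ≥0) (σ α : ℕ → ℝ≥0) :
    (lindley t x σ α : ℝ) = max (netInput σ α t + x) (lindley t 0 σ α) := by
  induction t generalizing σ α with
  | zero => simp [lindley, netInput]
  | succ t ih =>
    simp only [lindley, NNReal.coe_add, NNReal.coe_sub_def, ih (fun n => σ (n + 1)),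
      netInput_succ']
    generalize netInput (fun n => σ (n + 1)) (fun n => α (n + 1)) t = u
    generalize (lindley t 0 (fun n => σ (n + 1)) (fun n => α (n + 1)) : ℝ) = l
    simp only [max_def]
    split_ifs <;> linarith

theorem monotone_lindley_zero (σ α : ℕ → ℝ≥0) : Monotone fun t => lindley t 0 σ α := by
  refine monotone_nat_of_le_succ fun t => ?_
  induction t generalizing σ α with
  | zero => exact zero_le
  | succ t ih => exact add_le_add (tsub_le_tsub_right (ih _ _) _) le_rfl

/-- After the last truncation, at index `k` say, the content is `α k`, which exceeds the net input
of indices up to `k` by at most `σ k ≤ s`. The offset `c` carries the net input of the indices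
already peeled off in the induction. -/
theorem add_lindley_zero_le {B s c : ℝ} (hs : 0 ≤ s) (t : ℕ) (σ α : ℕ → ℝ≥0)
    (hσ : ∀ n, (σ n : ℝ) ≤ s) (hB : ∀ k, c + netInput σ α k ≤ B) :
    c + lindley t 0 σ α ≤ B + s := by
  induction t generalizing σ α c with
  | zero =>
    have := hB 0
    simp only [netInput, Finset.range_zero, Finset.sum_empty] at this
    simp only [lindley, NNReal.coe_zero]
    linarith
  | succ t ih =>
    have h1 := @ih (c + ((α 0 : ℝ) - σ 0)) (fun n => σ (n + 1)) (fun n => α (n + 1))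
      (fun n => hσ _) fun k => by
        have := hB (k + 1)
        rw [netInput_succ'] at this
        linarith
    have h2 := hB 1
    have h3 := hσ 0
    simp only [netInput, Finset.sum_range_one] at h2
    simp only [lindley, NNReal.coe_add, NNReal.coe_sub_def]
    rcases max_cases ((lindley t 0 (fun n => σ (n + 1)) (fun n => α (n + 1)) : ℝ) - σ 0) 0 with
      ⟨h, -⟩ | ⟨h, -⟩ <;> rw [h] <;> linarith

theorem bddAbove_lindley_zero {σ α : ℕ → ℝ≥0} {s : ℝ≥0} (hσ : ∀ n, σ n ≤ s)
    (h : Tendsto (netInput σ α) atTop atBot) : BddAbove (Set.range fun t => lindley t 0 σ α) := by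
  obtain ⟨B, hB⟩ := h.isBoundedUnder_le_atBot.bddAbove_range
  refine ⟨(B + s).toNNReal, ?_⟩
  rintro _ ⟨t, rfl⟩
  refine NNReal.le_toNNReal_of_coe_le ?_
  have := add_lindley_zero_le (c := 0) s.2 t σ α (fun n => hσ n) (B := B)
    fun k => by simpa using hB ⟨k, rfl⟩
  simpa using this

theorem tendsto_lindley_zero {σ α : ℕ → ℝ≥0} {s : ℝ≥0} (hσ : ∀ n, σ n ≤ s)
    (h : Tendsto (netInput σ α) atTop atBot) :
    Tendsto (fun t => lindley t 0 σ α) atTop (𝓝 (loynes σ α)) :=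
  tendsto_atTop_ciSup (monotone_lindley_zero σ α) (bddAbove_lindley_zero hσ h)

/-- Convergence alone would control distribution functions only at continuity points of the limit.
Since the limit is approached from below, the event `≤ q` is eventually decided for every `q`, atoms
included. -/
theorem eventually_lindley_le_iff {σ α : ℕ → ℝ≥0} {s : ℝ≥0} (hσ : ∀ n, σ n ≤ s)
    (h : Tendsto (netInput σ α) atTop atBot) (x q : ℝ≥0) :
    ∀ᶠ t in atTop, lindley t x σ α ≤ q ↔ loynes σ α ≤ q := by
  have h1 : ∀ᶠ t in atTop, lindley t x σ α = lindley t 0 σ α := by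
    filter_upwards [h.eventually_le_atBot (-(x : ℝ))] with t ht
    rw [← NNReal.coe_inj, coe_lindley_eq_max]
    exact max_eq_right (le_trans (by linarith) (NNReal.coe_nonneg _))
  by_cases hq : loynes σ α ≤ q
  · filter_upwards [h1] with t ht
    rw [ht]
    exact iff_of_true ((le_ciSup (bddAbove_lindley_zero hσ h) t).trans hq) hq
  · obtain ⟨t₀, ht₀⟩ := exists_lt_of_lt_ciSup (not_le.1 hq)
    filter_upwards [h1, eventually_ge_atTop t₀] with t ht htt
    rw [ht]
    exact iff_of_false (not_le.2 (ht₀.trans_le (monotone_lindley_zero σ α htt))) hq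

theorem tendsto_netInput_shift {σ α : ℕ → ℝ≥0} (h : Tendsto (netInput σ α) atTop atBot) :
    Tendsto (netInput (fun n => σ (n + 1)) (fun n => α (n + 1))) atTop atBot := by
  have h1 := tendsto_atBot_add_const_right _ (-((α 0 : ℝ) - σ 0)) ((tendsto_add_atTop_iff_nat 1).2 h)
  simpa only [netInput_succ', add_neg_cancel_right] using h1

/-- The limit of the backward iterates is a fixed point of the recursion. -/
theorem loynes_shift {σ α : ℕ → ℝ≥0} {s : ℝ≥0} (hσ : ∀ n, σ n ≤ s)
    (h : Tendsto (netInput σ α) atTop atBot) :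
    loynes (fun n => σ (n + 1)) (fun n => α (n + 1)) - σ 0 + α 0 = loynes σ α := by
  have h1 := (tendsto_lindley_zero (fun n => hσ (n + 1)) (tendsto_netInput_shift h))
  have h2 := (h1.sub (tendsto_const_nhds (x := σ 0))).add (tendsto_const_nhds (x := α 0))
  exact tendsto_nhds_unique h2 ((tendsto_add_atTop_iff_nat 1).2 (tendsto_lindley_zero hσ h))

theorem lindley_zero_input (t : ℕ) (x : ℝ≥0) {σ α : ℕ → ℝ≥0} (hσ : ∀ n, σ n = 0)
    (hα : ∀ n, α n = 0) : lindley t x σ α = x := by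
  induction t generalizing σ α with
  | zero => rfl
  | succ t ih => rw [lindley, ih (fun n => hσ _) (fun n => hα _), hσ, hα]; simp

/-! ### Recursions driven by i.i.d. sequences -/

section Path

variable {W ι : Type*} [MeasurableSpace W] (ρ : Measure W) [IsProbabilityMeasure ρ]

/-- An i.i.d. sequence is an i.i.d. sequence preceded by an independent element. -/
theorem infinitePi_prod_map_cons :
    ((Measure.infinitePi fun _ : ℕ => ρ).prod ρ).map
      (fun z : (ℕ → W) × W => fun n => Nat.casesOn n z.2 z.1) = Measure.infinitePi fun _ => ρ := by
  classical
  have hm : Measurable (fun z : (ℕ → W) × W => (fun n => Nat.casesOn n z.2 z.1 : ℕ → W)) := by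
    refine measurable_pi_lambda _ fun n => ?_
    cases n with
    | zero => exact measurable_snd
    | succ n => exact (measurable_pi_apply n).comp measurable_fst
  refine Measure.eq_infinitePi _ fun s t ht => ?_
  rw [Measure.map_apply hm (MeasurableSet.pi s.countable_toSet fun i _ => ht i)]
  have hset : (fun z : (ℕ → W) × W => (fun n => Nat.casesOn n z.2 z.1 : ℕ → W)) ⁻¹'
      (Set.pi s t) = (Set.pi (s.preimage Nat.succ Nat.succ_injective.injOn)
        fun n => t (n + 1)) ×ˢ {w | 0 ∈ s → w ∈ t 0} := by
    ext ⟨ω, w⟩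
    simp only [Set.mem_preimage, Set.mem_pi, Finset.mem_coe, Set.mem_prod, Finset.mem_preimage,
      Set.mem_ofPred_eq]
    constructor
    · exact fun h => ⟨fun n hn => h _ hn, fun h0 => h 0 h0⟩
    · rintro ⟨h1, h2⟩ (_ | n) hn
      · exact h2 hn
      · exact h1 n hn
  rw [hset, Measure.prod_prod, Measure.infinitePi_pi _ fun i _ => ht _]
  have hpre : ∏ n ∈ s.preimage Nat.succ Nat.succ_injective.injOn, ρ (t (n + 1)) =
      ∏ n ∈ s.erase 0, ρ (t n) := by
    refine Finset.prod_bij (fun n _ => n + 1) (fun n hn => ?_) (fun _ _ _ _ h => by simpa using h)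
      (fun n hn => ?_) fun _ _ => rfl
    · simpa using hn
    · obtain ⟨h0, hs⟩ := Finset.mem_erase.1 hn
      obtain ⟨k, rfl⟩ := Nat.exists_eq_succ_of_ne_zero h0
      exact ⟨k, by simpa using hs, rfl⟩
  rw [hpre]
  by_cases h0 : 0 ∈ s
  · simp only [h0, true_imp_iff, Set.ofPred_mem_eq]
    rw [mul_comm, Finset.mul_prod_erase s (fun n => ρ (t n)) h0]
  · simp [h0]

theorem infinitePi_map_shift :
    (Measure.infinitePi fun _ : ℕ => ρ).map (fun ω => (fun n => ω (n + 1), ω 0)) =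
      (Measure.infinitePi fun _ : ℕ => ρ).prod ρ := by
  have hm : Measurable (fun z : (ℕ → W) × W => (fun n => Nat.casesOn n z.2 z.1 : ℕ → W)) := by
    refine measurable_pi_lambda _ fun n => ?_
    cases n with
    | zero => exact measurable_snd
    | succ n => exact (measurable_pi_apply n).comp measurable_fst
  conv_lhs => rw [← infinitePi_prod_map_cons ρ]
  rw [Measure.map_map (by fun_prop) hm]
  exact Measure.map_id

omit [IsProbabilityMeasure ρ] in
theorem map_prod_eq_map_prodMap {X Y : Type*} [MeasurableSpace X] [MeasurableSpace Y]
    (μ : Measure X) [SFinite μ] [SFinite ρ] {f : X → Y} (hf : Measurable f) :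
    (μ.map f).prod ρ = (μ.prod ρ).map (Prod.map f id) := by
  have := Measure.map_prod_map μ ρ hf measurable_id
  rwa [Measure.map_id] at this

variable (σ α : W → ι → ℝ≥0)

/-- One step of the recursion, with the service and arrivals determined by `w`. -/
def recursionStep (z : (ι → ℝ≥0) × W) : ι → ℝ≥0 := fun i => z.1 i - σ z.2 i + α z.2 i

/-- The vector of backward iterates along a sequence. -/
def backward (t : ℕ) (z : (ι → ℝ≥0) × (ℕ → W)) : ι → ℝ≥0 :=
  fun i => lindley t (z.1 i) (fun n => σ (z.2 n) i) (fun n => α (z.2 n) i)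

/-- The vector of limits of the backward iterates along a sequence. -/
def loynesVector (ω : ℕ → W) : ι → ℝ≥0 :=
  fun i => loynes (fun n => σ (ω n) i) (fun n => α (ω n) i)

variable {σ α}

theorem measurable_recursionStep (hσ : Measurable σ) (hα : Measurable α) :
    Measurable (recursionStep σ α) := by
  unfold recursionStep
  fun_prop

theorem measurable_backward (hσ : Measurable σ) (hα : Measurable α) (t : ℕ) :
    Measurable (backward σ α t) := by
  induction t with
  | zero => exact measurable_fst
  | succ t ih =>
    have : backward σ α (t + 1) = fun z =>
      recursionStep σ α (backward σ α t (z.1, fun n => z.2 (n + 1)), z.2 0) := rfl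
    rw [this]
    have := measurable_recursionStep hσ hα
    fun_prop

theorem measurable_loynesVector (hσ : Measurable σ) (hα : Measurable α) :
    Measurable (loynesVector σ α) := by
  refine measurable_pi_lambda _ fun i => Measurable.iSup fun t => ?_
  have h := measurable_backward hσ hα t
  exact (measurable_pi_apply i).comp (h.comp (measurable_prodMk_left (x := (0 : ι → ℝ≥0))))

/-- The last map applied uses coordinate `0`, independent of the shifted sequence that drives the
first `t` maps, and the shifted sequence has the original law. Thus backward iterates reproduce the
forward laws time by time, though not the joint law over time. -/
theorem map_backward_succ (hσ : Measurable σ) (hα : Measurable α) (μ₀ : Measure (ι → ℝ≥0))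
    [IsProbabilityMeasure μ₀] (t : ℕ) :
    (μ₀.prod (Measure.infinitePi fun _ => ρ)).map (backward σ α (t + 1)) =
      (((μ₀.prod (Measure.infinitePi fun _ => ρ)).map (backward σ α t)).prod ρ).map
        (recursionStep σ α) := by
  have hs := measurable_recursionStep hσ hα
  have hb := measurable_backward hσ hα t
  have h1 : (((μ₀.prod (Measure.infinitePi fun _ => ρ)).map (backward σ α t)).prod ρ) =
      ((μ₀.prod (Measure.infinitePi fun _ => ρ)).prod ρ).map
        (Prod.map (backward σ α t) id) := map_prod_eq_map_prodMap ρ _ hb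
  have h2 : (μ₀.prod (Measure.infinitePi fun _ : ℕ => ρ)).prod ρ =
      (μ₀.prod (Measure.infinitePi fun _ : ℕ => ρ)).map
        (fun z => ((z.1, fun n => z.2 (n + 1)), z.2 0)) := by
    rw [← MeasurePreserving.map_eq (measurePreserving_prodAssoc μ₀ _ ρ).symm,
      ← infinitePi_map_shift ρ]
    have h3 := Measure.map_prod_map μ₀ (Measure.infinitePi fun _ : ℕ => ρ) measurable_id
      (g := fun ω : ℕ → W => (fun n => ω (n + 1), ω 0)) (by fun_prop)
    rw [Measure.map_id] at h3
    rw [h3, Measure.map_map (MeasurableEquiv.measurable _) (by fun_prop)]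
    rfl
  rw [h1, h2, Measure.map_map hs (hb.prodMap measurable_id),
    Measure.map_map (hs.comp (hb.prodMap measurable_id)) (by fun_prop)]
  rfl

/-- The law of large numbers for the net input of coordinate `i`. -/
theorem ae_tendsto_netInput (i : ι) (hσ : Measurable σ) (hα : Measurable α)
    (hσi : Integrable (fun w => (σ w i : ℝ)) ρ) (hαi : Integrable (fun w => (α w i : ℝ)) ρ)
    (hlt : ∫ w, (α w i : ℝ) ∂ρ < ∫ w, (σ w i : ℝ) ∂ρ) :
    ∀ᵐ ω ∂(Measure.infinitePi fun _ : ℕ => ρ),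
      Tendsto (netInput (fun n => σ (ω n) i) (fun n => α (ω n) i)) atTop atBot := by
  let Y : W → ℝ := fun w => (α w i : ℝ) - σ w i
  have hY : Measurable Y := by fun_prop
  have hYint : Integrable Y ρ := hαi.sub hσi
  have hmp : ∀ n : ℕ, MeasurePreserving (fun ω : ℕ → W => ω n)
      (Measure.infinitePi fun _ => ρ) ρ := fun n => measurePreserving_eval_infinitePi _ n
  have hind : iIndepFun (fun (n : ℕ) (ω : ℕ → W) => Y (ω n)) (Measure.infinitePi fun _ => ρ) :=
    iIndepFun_infinitePi (P := fun _ => ρ) (X := fun _ => Y) fun _ => hY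
  have hlaw : ∀ n : ℕ, (Measure.infinitePi fun _ => ρ).map (fun ω : ℕ → W => Y (ω n)) =
      ρ.map Y := fun n => by
    conv_rhs => rw [← (hmp n).map_eq, Measure.map_map hY (hmp n).measurable]
    rfl
  have hslln := strong_law_ae_real (μ := Measure.infinitePi fun _ : ℕ => ρ)
    (fun n ω => Y (ω n)) ((hmp 0).integrable_comp_of_integrable hYint)
    (fun n k hnk => hind.indepFun hnk)
    (fun n => ⟨(hY.comp (hmp n).measurable).aemeasurable,
      (hY.comp (hmp 0).measurable).aemeasurable, (hlaw n).trans (hlaw 0).symm⟩)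
  have hmean : ∫ ω : ℕ → W, Y (ω 0) ∂(Measure.infinitePi fun _ : ℕ => ρ) < 0 := by
    have h1 : ∫ ω : ℕ → W, Y (ω 0) ∂(Measure.infinitePi fun _ : ℕ => ρ) = ∫ w, Y w ∂ρ := by
      conv_rhs => rw [← (hmp 0).map_eq]
      rw [integral_map (hmp 0).measurable.aemeasurable
        hY.aestronglyMeasurable]
    rw [h1, integral_sub hαi hσi]
    linarith
  filter_upwards [hslln] with ω hω
  have h := Tendsto.atTop_mul_neg hmean tendsto_natCast_atTop_atTop hω
  refine h.congr' ?_
  filter_upwards [eventually_gt_atTop 0] with n hn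
  have : (n : ℝ) ≠ 0 := by positivity
  rw [mul_div_cancel₀ _ this]
  rfl

theorem tendsto_measure_backward (i : ι) (hσ : Measurable σ) (hα : Measurable α) {s : ℝ≥0}
    (hs : ∀ w, σ w i ≤ s)
    (h : ∀ᵐ ω ∂(Measure.infinitePi fun _ : ℕ => ρ),
      Tendsto (netInput (fun n => σ (ω n) i) (fun n => α (ω n) i)) atTop atBot)
    (μ₀ : Measure (ι → ℝ≥0)) [IsProbabilityMeasure μ₀] (q : ℝ≥0) :
    Tendsto (fun t => ((μ₀.prod (Measure.infinitePi fun _ => ρ)).map (backward σ α t)).real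
      {x | x i ≤ q}) atTop
      (𝓝 (((Measure.infinitePi fun _ => ρ).map (loynesVector σ α)).real {x | x i ≤ q})) := by
  have hset : MeasurableSet {x : ι → ℝ≥0 | x i ≤ q} :=
    measurableSet_le (measurable_pi_apply i) measurable_const
  have hl := measurable_loynesVector hσ hα
  have hb := measurable_backward hσ hα
  have hlim : (Measure.infinitePi fun _ => ρ).map (loynesVector σ α) =
      (μ₀.prod (Measure.infinitePi fun _ => ρ)).map (fun z => loynesVector σ α z.2) := by
    have : (μ₀.prod (Measure.infinitePi fun _ : ℕ => ρ)).map Prod.snd =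
      Measure.infinitePi fun _ => ρ := by simp
    conv_lhs => rw [← this]
    rw [Measure.map_map hl measurable_snd]
    rfl
  rw [hlim]
  have hl2 : Measurable fun z : (ι → ℝ≥0) × (ℕ → W) => loynesVector σ α z.2 :=
    hl.comp measurable_snd
  simp only [Measure.real, Measure.map_apply (hb _) hset, Measure.map_apply hl2 hset]
  refine (ENNReal.tendsto_toReal (measure_ne_top (μ₀.prod (Measure.infinitePi fun _ : ℕ => ρ)) _)).comp ?_
  -- Almost surely the indicators of the events `≤ q` are eventually constant, so their
  -- probabilities converge.
  refine tendsto_measure_of_ae_tendsto_indicator_of_isFiniteMeasure atTop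
    (hl2 hset) (fun t => hb t hset) ?_
  have hsnd : ∀ᵐ z ∂(μ₀.prod (Measure.infinitePi fun _ : ℕ => ρ)),
      Tendsto (netInput (fun n => σ (z.2 n) i) (fun n => α (z.2 n) i)) atTop atBot :=
    Measure.quasiMeasurePreserving_snd.ae h
  filter_upwards [hsnd] with z hz
  exact eventually_lindley_le_iff (fun n => hs _) hz (z.1 i) q

/-- Feeding a fresh slot to the limit amounts to prepending that slot to the sequence, which
preserves the i.i.d. law; `loynes_shift` identifies the result with the limit along the longer
sequence. -/
theorem map_loynesVector_eq [Countable ι] (hσ : Measurable σ) (hα : Measurable α) {s : ℝ≥0}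
    (hs : ∀ w i, σ w i ≤ s)
    (h : ∀ i, ∀ᵐ ω ∂(Measure.infinitePi fun _ : ℕ => ρ),
      Tendsto (netInput (fun n => σ (ω n) i) (fun n => α (ω n) i)) atTop atBot) :
    (((Measure.infinitePi fun _ => ρ).map (loynesVector σ α)).prod ρ).map (recursionStep σ α) =
      (Measure.infinitePi fun _ => ρ).map (loynesVector σ α) := by
  have hl := measurable_loynesVector hσ hα
  have hr := measurable_recursionStep hσ hα
  have h1 : ((Measure.infinitePi fun _ => ρ).map (loynesVector σ α)).prod ρ =
      ((Measure.infinitePi fun _ => ρ).prod ρ).map (Prod.map (loynesVector σ α) id) := by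
    exact map_prod_eq_map_prodMap ρ _ hl
  rw [h1, ← infinitePi_map_shift ρ, Measure.map_map hr (hl.prodMap measurable_id),
    Measure.map_map (hr.comp (hl.prodMap measurable_id)) (by fun_prop)]
  refine Measure.map_congr ?_
  filter_upwards [ae_all_iff.2 h] with ω hω
  funext i
  exact loynes_shift (fun n => hs _ _) (hω i)

end Path

/-! ### Geometry of the rate region -/

variable {N : ℕ} {S : Finset ℝ≥0}

theorem mem_convexHull_insert_zero_range_iff {ι E : Type*} [Fintype ι] [AddCommGroup E] [Module ℝ E]
    (v : ι → E) (x : E) :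
    x ∈ convexHull ℝ (insert 0 (Set.range v)) ↔
      ∃ p : ι → ℝ, (∀ i, 0 ≤ p i) ∧ ∑ i, p i ≤ 1 ∧ x = ∑ i, p i • v i := by
  classical
  constructor
  · intro hx
    have hconv : Convex ℝ {x : E | ∃ p : ι → ℝ, (∀ i, 0 ≤ p i) ∧ ∑ i, p i ≤ 1 ∧
        x = ∑ i, p i • v i} := by
      rintro _ ⟨p, hp, hp1, rfl⟩ _ ⟨q, hq, hq1, rfl⟩ a b ha hb hab
      refine ⟨fun i => a * p i + b * q i, fun i => ?_, ?_, ?_⟩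
      · have := hp i; have := hq i; positivity
      · rw [Finset.sum_add_distrib, ← Finset.mul_sum, ← Finset.mul_sum]
        nlinarith
      · simp only [Finset.smul_sum, add_smul, mul_smul, Finset.sum_add_distrib]
    refine convexHull_min ?_ hconv hx
    rintro y (rfl | ⟨i, rfl⟩)
    · exact ⟨0, by simp, by simp, by simp⟩
    · refine ⟨Pi.single i 1, fun j => ?_, ?_, ?_⟩
      · by_cases h : j = i <;> simp [h]
      · simp
      · simp [Pi.single_apply]
  · rintro ⟨p, hp, hp1, rfl⟩
    -- The index `none` gives the missing weight `1 - ∑ i, p i` to the vertex `0`.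
    have h := (convex_convexHull ℝ (insert 0 (Set.range v))).sum_mem (t := Finset.univ)
      (w := fun o : Option ι => o.elim (1 - ∑ i, p i) p) (z := fun o => o.elim 0 v)
      (by rintro (_ | i) -
          · simpa using hp1
          · exact hp i)
      (by simp [Fintype.sum_option])
      (by rintro (_ | i) -
          · exact subset_convexHull ℝ _ (by simp)
          · exact subset_convexHull ℝ _ (by simp))
    simpa [Fintype.sum_option] using h

theorem estimateProb_nonneg (P : JointStatistics N S) (chat : Fin N → S) :
    0 ≤ estimateProb P chat :=
  Finset.prod_nonneg fun _ _ => measureReal_nonneg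

theorem expectedRate_nonneg (P : JointStatistics N S) (i : Fin N) (chat r : S) :
    0 ≤ expectedRate P i chat r :=
  mul_nonneg measureReal_nonneg (NNReal.coe_nonneg _)

/-- The number `p chat i` acts as the probability of scheduling user `i` when the estimates are
`chat`; the missing mass corresponds to idling. -/
theorem mem_rateRegion_iff (P : JointStatistics N S) (rstar : Fin N → S → S) (lam : Fin N → ℝ) :
    lam ∈ rateRegion P rstar ↔ ∃ p : (Fin N → S) → Fin N → ℝ, (∀ chat i, 0 ≤ p chat i) ∧
      (∀ chat, ∑ i, p chat i ≤ 1) ∧ ∀ i, lam i =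
        ∑ chat, estimateProb P chat * (p chat i * expectedRate P i (chat i) (rstar i (chat i))) := by
  classical
  have key : ∀ (chat : Fin N → S) (p : Fin N → ℝ) (j : Fin N),
      (∑ i, p i • expectedRate P i (chat i) (rstar i (chat i)) • (Pi.single i 1 : Fin N → ℝ)) j =
        p j * expectedRate P j (chat j) (rstar j (chat j)) := by
    intro chat p j
    simp [Finset.sum_apply, Pi.single_apply]
  unfold rateRegion
  rw [Set.mem_finsetSum]
  constructor
  · rintro ⟨g, hg, rfl⟩
    have h1 : ∀ chat, ∃ p : Fin N → ℝ, (∀ i, 0 ≤ p i) ∧ ∑ i, p i ≤ 1 ∧ g chat =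
        estimateProb P chat • ∑ i, p i • expectedRate P i (chat i) (rstar i (chat i)) •
          (Pi.single i 1 : Fin N → ℝ) := by
      intro chat
      obtain ⟨y, hy, hgy⟩ := Set.mem_smul_set.1 (hg (Finset.mem_univ chat))
      obtain ⟨p, hp, hp1, rfl⟩ := (mem_convexHull_insert_zero_range_iff _ _).1 hy
      exact ⟨p, hp, hp1, hgy.symm⟩
    choose p hp hp1 hgp using h1
    refine ⟨p, hp, hp1, fun i => ?_⟩
    rw [Finset.sum_apply]
    refine Finset.sum_congr rfl fun chat _ => ?_
    rw [hgp, Pi.smul_apply, key, smul_eq_mul]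
  · rintro ⟨p, hp, hp1, hlam⟩
    refine ⟨fun chat => estimateProb P chat • ∑ i, p chat i •
      expectedRate P i (chat i) (rstar i (chat i)) • (Pi.single i 1 : Fin N → ℝ), ?_, ?_⟩
    · intro chat _
      exact Set.smul_mem_smul_set
        ((mem_convexHull_insert_zero_range_iff _ _).2 ⟨p chat, hp chat, hp1 chat, rfl⟩)
    · funext i
      rw [hlam i, Finset.sum_apply]
      refine Finset.sum_congr rfl fun chat _ => ?_
      rw [Pi.smul_apply, key, smul_eq_mul]

theorem convex_rateRegion (P : JointStatistics N S) (rstar : Fin N → S → S) :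
    Convex ℝ (rateRegion P rstar) :=
  convex_sum _ fun _ _ => (convex_convexHull ℝ _).smul _

theorem isCompact_finsetSum {ι E : Type*} [AddCommMonoid E] [TopologicalSpace E] [ContinuousAdd E]
    (s : Finset ι) (f : ι → Set E) (hf : ∀ i, IsCompact (f i)) : IsCompact (∑ i ∈ s, f i) := by
  classical
  induction s using Finset.induction_on with
  | empty => simp
  | insert a s ha ih => rw [Finset.sum_insert ha]; exact (hf a).add ih

theorem isClosed_rateRegion (P : JointStatistics N S) (rstar : Fin N → S → S) :
    IsClosed (rateRegion P rstar) := by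
  refine (isCompact_finsetSum _ _ fun chat => IsCompact.smul _ ?_).isClosed
  exact Set.Finite.isCompact_convexHull (𝕜 := ℝ) ((Set.finite_range _).insert _)

theorem nonneg_of_mem_rateRegion {P : JointStatistics N S} {rstar : Fin N → S → S}
    {lam : Fin N → ℝ} (h : lam ∈ rateRegion P rstar) : 0 ≤ lam := by
  obtain ⟨p, hp, -, hlam⟩ := (mem_rateRegion_iff _ _ _).1 h
  intro i
  rw [hlam i]
  exact Finset.sum_nonneg fun chat _ => mul_nonneg (estimateProb_nonneg _ _)
    (mul_nonneg (hp _ _) (expectedRate_nonneg _ _ _ _))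

theorem mem_rateRegion_of_le {P : JointStatistics N S} {rstar : Fin N → S → S}
    {lam lam' : Fin N → ℝ} (h : lam ∈ rateRegion P rstar) (h0 : 0 ≤ lam') (hle : lam' ≤ lam) :
    lam' ∈ rateRegion P rstar := by
  obtain ⟨p, hp, hp1, hlam⟩ := (mem_rateRegion_iff _ _ _).1 h
  have hq0 : ∀ i, 0 ≤ lam' i / lam i := fun i => div_nonneg (h0 i) ((h0 i).trans (hle i))
  have hq1 : ∀ i, lam' i / lam i ≤ 1 := fun i => div_le_one_of_le₀ (hle i) ((h0 i).trans (hle i))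
  -- Each user's scheduling probabilities are scaled down separately. If `lam i = 0`, then `lam' i =
  -- 0` as well and the quotient is `0` by convention.
  refine (mem_rateRegion_iff _ _ _).2 ⟨fun chat i => lam' i / lam i * p chat i,
    fun chat i => mul_nonneg (hq0 i) (hp _ _), fun chat => ?_, fun i => ?_⟩
  · exact (Finset.sum_le_sum fun i _ => mul_le_of_le_one_left (hp _ _) (hq1 i)).trans (hp1 chat)
  · have : lam' i = lam' i / lam i * lam i := by
      rcases eq_or_ne (lam i) 0 with h | h
      · have := hle i; have := h0 i; simp at *; rw [h]; simp; linarith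
      · field_simp
    rw [this, hlam i, Finset.mul_sum]
    refine Finset.sum_congr rfl fun chat _ => ?_
    rw [← hlam i]
    ring

/-! ### Mean service under an arbitrary policy -/

/-- The service offered to user `i` in a slot with the given channels, estimates and decision. -/
def service (i : Fin N) (d : (Fin N → S × S) × (Fin N × S)) : ℝ≥0 :=
  if d.2.1 = i ∧ d.2.2 ≤ (d.1 i).1 then (d.2.2 : ℝ≥0) else 0

theorem nextQueue_apply (x : Fin N → ℝ≥0)
    (w : ((Fin N → S × S) × (Fin N × S)) × (Fin N → ℝ≥0)) (i : Fin N) :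
    nextQueue (x, w) i = x i - service i w.1 + w.2 i := rfl

theorem measurable_service (i : Fin N) : Measurable (service (S := S) i) := measurable_of_finite _

theorem channelLaw_real_estimates_eq (P : JointStatistics N S) (i : Fin N) (chat : Fin N → S)
    (r : S) :
    (channelLaw P).real {w | estimates w = chat ∧ r ≤ (w i).1} =
      estimateProb P chat * successProb P i (chat i) r := by
  classical
  have hset : {w : Fin N → S × S | estimates w = chat ∧ r ≤ (w i).1} =
      Set.pi Set.univ fun j => {x : S × S | x.2 = chat j} ∩ {x | j = i → r ≤ x.1} := by
    ext w
    simp only [estimates, Set.mem_ofPred_eq, Set.mem_pi, Set.mem_univ, true_imp_iff,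
      Set.mem_inter_iff, funext_iff]
    constructor
    · rintro ⟨h1, h2⟩ j
      exact ⟨h1 j, by rintro rfl; exact h2⟩
    · exact fun h => ⟨fun j => (h j).1, (h i).2 rfl⟩
  rw [hset, channelLaw, Measure.real, Measure.pi_pi, ENNReal.toReal_prod, estimateProb,
    ← Finset.mul_prod_erase _ _ (Finset.mem_univ i),
    ← Finset.mul_prod_erase (a := i) _ _ (Finset.mem_univ i)]
  have h1 : ∀ j ∈ Finset.univ.erase i,
      ((P j).toMeasure ({x : S × S | x.2 = chat j} ∩ {x | j = i → r ≤ x.1})).toReal =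
        (P j).toMeasure.real {x | x.2 = chat j} := by
    intro j hj
    have : {x : S × S | j = i → r ≤ x.1} = Set.univ := by
      ext x; simp [Finset.ne_of_mem_erase hj]
    rw [this, Set.inter_univ]; rfl
  rw [Finset.prod_congr rfl h1]
  have h2 : ((P i).toMeasure ({x : S × S | x.2 = chat i} ∩ {x | i = i → r ≤ x.1})).toReal =
      successProb P i (chat i) r * (P i).toMeasure.real {x | x.2 = chat i} := by
    -- This also covers an estimate of probability zero, where both sides vanish.
    have := cond_mul_eq_inter (μ := (P i).toMeasure) (s := {x : S × S | x.2 = chat i})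
      (Set.toFinite _).measurableSet {x | r ≤ x.1}
    simp only [true_imp_iff]
    rw [← this, ENNReal.toReal_mul]
    rfl
  rw [h2]
  ring

theorem integral_service (P : JointStatistics N S) (φ : StationaryPolicy N S)
    (x : Fin N → ℝ≥0) (i : Fin N) :
    ∫ d, (service i d : ℝ) ∂(decisionKernel P φ x) =
      ∑ chat, estimateProb P chat *
        ∑ r, (φ.kernel (x, chat)).real {(i, r)} * expectedRate P i (chat i) r := by
  classical
  have hfin : ∀ {α : Type} [Finite α] [MeasurableSpace α] [MeasurableSingletonClass α]
      (μ : Measure α) [IsFiniteMeasure μ] (f : α → ℝ), Integrable f μ := by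
    intro α _ _ _ μ _ f
    exact Integrable.of_finite
  rw [decisionKernel, integral_compProd (hfin _ _)]
  have hinner : ∀ w : Fin N → S × S,
      ∫ d, (service i (w, d) : ℝ) ∂(φ.kernel.comap
        (fun p : (Fin N → ℝ≥0) × (Fin N → S × S) => (p.1, estimates p.2))
        (by unfold estimates; fun_prop) (x, w)) =
      ∑ chat, ∑ r, (φ.kernel (x, chat)).real {(i, r)} * (r : ℝ≥0) *
        Set.indicator {w | estimates w = chat ∧ r ≤ (w i).1} 1 w := by
    intro w
    rw [Kernel.comap_apply, integral_fintype (hfin _ _), Fintype.sum_prod_type,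
      Finset.sum_eq_single i, Finset.sum_eq_single (estimates w)]
    · refine Finset.sum_congr rfl fun r _ => ?_
      by_cases h : r ≤ (w i).1 <;> simp [service, h]
    · intro chat _ hne
      refine Finset.sum_eq_zero fun r _ => ?_
      simp [Ne.symm hne]
    · simp
    · intro j _ hne
      refine Finset.sum_eq_zero fun r _ => ?_
      simp [service, hne]
    · simp
  simp only [Kernel.const_apply]
  rw [integral_congr_ae (Eventually.of_forall hinner), integral_finsetSum _ fun _ _ => hfin _ _]
  refine Finset.sum_congr rfl fun chat _ => ?_
  rw [integral_finsetSum _ fun _ _ => hfin _ _, Finset.mul_sum]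
  refine Finset.sum_congr rfl fun r _ => ?_
  rw [integral_const_mul, integral_indicator_one (Set.toFinite _).measurableSet,
    channelLaw_real_estimates_eq, expectedRate]
  ring

/-- Replacing each chosen rate by an optimal one does not lower the mean service and produces the
point of the region whose weights are the policy's scheduling probabilities. -/
theorem integral_service_mem_rateRegion {P : JointStatistics N S} {rstar : Fin N → S → S}
    (hr : IsOptimalRate P rstar) (φ : StationaryPolicy N S) (x : Fin N → ℝ≥0) :
    (fun i => ∫ d, (service i d : ℝ) ∂(decisionKernel P φ x)) ∈ rateRegion P rstar := by
  classical
  refine mem_rateRegion_of_le (lam := fun i => ∑ chat, estimateProb P chat *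
    ((∑ r, (φ.kernel (x, chat)).real {(i, r)}) * expectedRate P i (chat i) (rstar i (chat i))))
    ((mem_rateRegion_iff _ _ _).2 ⟨fun chat i => ∑ r, (φ.kernel (x, chat)).real {(i, r)},
      fun chat i => Finset.sum_nonneg fun _ _ => measureReal_nonneg, fun chat => ?_, fun i => rfl⟩)
    (fun i => integral_nonneg fun _ => NNReal.coe_nonneg _) fun i => ?_
  · rw [← Fintype.sum_prod_type (fun p : Fin N × S => (φ.kernel (x, chat)).real {p}),
      sum_measureReal_singleton]
    simp
  · simp only [integral_service, Finset.sum_mul]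
    refine Finset.sum_le_sum fun chat _ => mul_le_mul_of_nonneg_left
      (Finset.sum_le_sum fun r _ => mul_le_mul_of_nonneg_left (hr _ _ _) measureReal_nonneg)
      (estimateProb_nonneg _ _)

/-! ### Necessity: drift of truncated queue lengths -/

theorem queueKernel_apply (P : JointStatistics N S) (φ : StationaryPolicy N S)
    (ν : Measure (Fin N → ℝ≥0)) [IsProbabilityMeasure ν] (x : Fin N → ℝ≥0) :
    queueKernel P φ ν x = ((decisionKernel P φ x).prod ν).map fun w => nextQueue (x, w) := by
  rw [queueKernel, Kernel.map_apply _ measurable_nextQueue, Kernel.prod_apply, Kernel.prod_apply,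
    Kernel.id_apply, Kernel.const_apply, Measure.dirac_prod,
    Measure.map_map measurable_nextQueue (by fun_prop)]
  rfl

theorem isProbabilityMeasure_queueLaw (P : JointStatistics N S) (φ : StationaryPolicy N S)
    (ν μ₀ : Measure (Fin N → ℝ≥0)) [IsProbabilityMeasure ν] [IsProbabilityMeasure μ₀] (t : ℕ) :
    IsProbabilityMeasure (queueLaw P φ ν μ₀ t) := by
  induction t with
  | zero => assumption
  | succ t ih => rw [queueLaw]; infer_instance

theorem service_le (i : Fin N) (d : (Fin N → S × S) × (Fin N × S)) :
    service i d ≤ S.sup id := by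
  unfold service
  split_ifs
  · exact Finset.le_sup (f := id) d.2.2.2
  · exact zero_le

theorem lintegral_service_le (P : JointStatistics N S) (φ : StationaryPolicy N S)
    (x : Fin N → ℝ≥0) (i : Fin N) :
    ∫⁻ d, service i d ∂(decisionKernel P φ x) ≤ (S.sup id : ℝ≥0) := by
  calc ∫⁻ d, service i d ∂(decisionKernel P φ x)
      ≤ ∫⁻ _, (S.sup id : ℝ≥0) ∂(decisionKernel P φ x) :=
        lintegral_mono fun d => ENNReal.coe_le_coe.2 (service_le i d)
    _ = _ := by simp

theorem measurable_lintegral_service (P : JointStatistics N S) (φ : StationaryPolicy N S)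
    (i : Fin N) :
    Measurable fun x => ∫⁻ d, service i d ∂(decisionKernel P φ x) :=
  (measurable_service i).coe_nnreal_ennreal.lintegral_kernel

theorem lintegral_lintegral_service_ne_top (P : JointStatistics N S) (φ : StationaryPolicy N S)
    (μ : Measure (Fin N → ℝ≥0)) [IsProbabilityMeasure μ] (i : Fin N) :
    ∫⁻ x, ∫⁻ d, service i d ∂(decisionKernel P φ x) ∂μ ≠ ⊤ := by
  refine ne_top_of_le_ne_top (b := ((S.sup id : ℝ≥0) : ENNReal)) ENNReal.coe_ne_top ?_
  calc ∫⁻ x, ∫⁻ d, service i d ∂(decisionKernel P φ x) ∂μ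
      ≤ ∫⁻ _, (S.sup id : ℝ≥0) ∂μ := lintegral_mono fun x => lintegral_service_le P φ x i
    _ = _ := by simp

/-- The mean service vector, over queue lengths of any law, is an element of the rate region. -/
theorem toReal_lintegral_service_mem_rateRegion {P : JointStatistics N S} {rstar : Fin N → S → S}
    (hr : IsOptimalRate P rstar) (φ : StationaryPolicy N S) (μ : Measure (Fin N → ℝ≥0))
    [IsProbabilityMeasure μ] :
    (fun i => (∫⁻ x, ∫⁻ d, service i d ∂(decisionKernel P φ x) ∂μ).toReal) ∈
      rateRegion P rstar := by
  have hd : ∀ x i, ∫ d, (service i d : ℝ) ∂(decisionKernel P φ x) =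
      (∫⁻ d, service i d ∂(decisionKernel P φ x)).toReal := by
    intro x i
    rw [← integral_toReal (measurable_service i).coe_nnreal_ennreal.aemeasurable
      (Eventually.of_forall fun _ => ENNReal.coe_lt_top)]
    rfl
  have hint : ∀ i, Integrable
      (fun x => (∫⁻ d, service i d ∂(decisionKernel P φ x)).toReal) μ := fun i =>
    integrable_toReal_of_lintegral_ne_top (measurable_lintegral_service P φ i).aemeasurable
      (lintegral_lintegral_service_ne_top P φ μ i)
  -- A closed convex set contains the mean of any integrable function with values in it.
  have h := (convex_rateRegion P rstar).integral_mem (isClosed_rateRegion P rstar) (μ := μ)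
    (f := fun x i => (∫⁻ d, service i d ∂(decisionKernel P φ x)).toReal)
    (Eventually.of_forall fun x => by
      simpa only [hd] using integral_service_mem_rateRegion hr φ x)
    (Integrable.of_eval hint)
  convert h using 1
  funext i
  rw [eval_integral hint, integral_toReal (measurable_lintegral_service P φ i).aemeasurable]
  exact Eventually.of_forall fun x =>
    (lintegral_service_le P φ x i).trans_lt ENNReal.coe_lt_top

/-- The level `2 * K` leaves room for an arrival cut at `K` on top of a content of at most `K`. If
the next length exceeds `2 * K`, its truncation is already maximal; otherwise the recursion itself
gives the bound. -/
theorem truncated_step_le (q s a K : ℝ≥0) :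
    min q (2 * K) + (if q ≤ K then min a K else 0) ≤ min (q - s + a) (2 * K) + s := by
  have h1 : q ≤ q - s + s := le_tsub_add
  rcases le_total (q - s + a) (2 * K) with h | h
  · rw [min_eq_left h]
    have h2 : min q (2 * K) ≤ q := min_le_left _ _
    have h3 : (if q ≤ K then min a K else 0) ≤ a := by
      split_ifs
      · exact min_le_left _ _
      · exact zero_le
    calc _ ≤ q + a := add_le_add h2 h3
      _ ≤ q - s + s + a := by gcongr
      _ = _ := by ring
  · rw [min_eq_right h]
    refine le_add_right ?_
    split_ifs with hq
    · calc _ ≤ K + K := add_le_add ((min_le_left _ _).trans hq) (min_le_right _ _)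
        _ = 2 * K := by ring
    · simp

/-- Drift inequality for the truncated queue length. -/
theorem lintegral_truncated_le (P : JointStatistics N S) (φ : StationaryPolicy N S)
    (ν μ : Measure (Fin N → ℝ≥0)) [IsProbabilityMeasure ν]
    (i : Fin N) (K : ℝ≥0) :
    ∫⁻ x, (min (x i) (2 * K) : ℝ≥0) ∂μ + μ {x | x i ≤ K} * ∫⁻ a, (min (a i) K : ℝ≥0) ∂ν ≤
      ∫⁻ x, (min (x i) (2 * K) : ℝ≥0) ∂(μ.bind (queueKernel P φ ν)) +
        ∫⁻ x, ∫⁻ d, service i d ∂(decisionKernel P φ x) ∂μ := by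
  have hmin : ∀ K : ℝ≥0, Measurable fun x : Fin N → ℝ≥0 => ((min (x i) K : ℝ≥0) : ENNReal) :=
    fun K => by fun_prop
  have hset : MeasurableSet {x : Fin N → ℝ≥0 | x i ≤ K} :=
    measurableSet_le (by fun_prop) measurable_const
  rw [Measure.lintegral_bind (Kernel.aemeasurable _) (hmin _).aemeasurable,
    ← lintegral_add_right _ (measurable_lintegral_service P φ i), mul_comm (μ _),
    ← lintegral_indicator_const hset, ← lintegral_add_left (hmin _)]
  refine lintegral_mono fun x => ?_
  have hw : Measurable fun w : ((Fin N → S × S) × (Fin N × S)) × (Fin N → ℝ≥0) =>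
      nextQueue (x, w) := measurable_nextQueue.comp measurable_prodMk_left
  rw [queueKernel_apply, lintegral_map (hmin _) hw]
  have hs : ∫⁻ d, service i d ∂(decisionKernel P φ x) =
      ∫⁻ w, service i w.1 ∂((decisionKernel P φ x).prod ν) := by
    have hm : Measurable fun w : ((Fin N → S × S) × (Fin N × S)) × (Fin N → ℝ≥0) =>
        (service i w.1 : ENNReal) :=
      ((measurable_service i).comp measurable_fst).coe_nnreal_ennreal
    rw [lintegral_prod _ hm.aemeasurable]
    simp
  have ha : Set.indicator {x : Fin N → ℝ≥0 | x i ≤ K}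
        (fun _ => ∫⁻ a, (min (a i) K : ℝ≥0) ∂ν) x =
      ∫⁻ w, ((if x i ≤ K then min (w.2 i) K else 0 : ℝ≥0) : ENNReal)
        ∂((decisionKernel P φ x).prod ν) := by
    have hm : Measurable fun w : ((Fin N → S × S) × (Fin N × S)) × (Fin N → ℝ≥0) =>
        ((if x i ≤ K then min (w.2 i) K else 0 : ℝ≥0) : ENNReal) := by
      split_ifs <;> fun_prop
    rw [lintegral_prod _ hm.aemeasurable]
    by_cases h : x i ≤ K <;> simp [h]
  have hx : ((min (x i) (2 * K) : ℝ≥0) : ENNReal) =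
      ∫⁻ _, ((min (x i) (2 * K) : ℝ≥0) : ENNReal) ∂((decisionKernel P φ x).prod ν) := by
    simp
  have hmw : Measurable fun w : ((Fin N → S × S) × (Fin N × S)) × (Fin N → ℝ≥0) =>
      ((min (nextQueue (x, w) i) (2 * K) : ℝ≥0) : ENNReal) := (hmin _).comp hw
  rw [hs, ha, hx, ← lintegral_add_left measurable_const, ← lintegral_add_left hmw]
  refine lintegral_mono fun w => ?_
  rw [nextQueue_apply, ← ENNReal.coe_add, ← ENNReal.coe_add]
  exact ENNReal.coe_le_coe.2 <| truncated_step_le (x i) (service i w.1) (w.2 i) K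

/-- If the queues are asymptotically tight, then the mean service rates come arbitrarily close to
the arrival rates from above. -/
theorem exists_mem_rateRegion_sub_le {P : JointStatistics N S} {rstar : Fin N → S → S}
    (hr : IsOptimalRate P rstar) {φ : StationaryPolicy N S} {lam : Fin N → ℝ}
    {ν μ₀ : Measure (Fin N → ℝ≥0)} (hν : IsArrivalLaw ν lam) [IsProbabilityMeasure μ₀]
    (hstab : ∀ i, QueueStable (queueLaw P φ ν μ₀) i) {ε : ℝ} (hε : 0 < ε) :
    ∃ v ∈ rateRegion P rstar, ∀ i, lam i - ε ≤ v i := by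
  classical
  have := hν.isProb
  have hprob := isProbabilityMeasure_queueLaw P φ ν μ₀
  choose F hF hlim using hstab
  let m : Fin N → ℝ≥0 → ℝ := fun i K => (∫⁻ a, (min (a i) K : ℝ≥0) ∂ν).toReal
  have hm : ∀ i, Tendsto (fun n : ℕ => m i n) atTop (𝓝 (lam i)) := by
    intro i
    have hfin : ∫⁻ a, (a i : ENNReal) ∂ν ≠ ⊤ := by
      have := (hν.integrable i).lintegral_lt_top
      simpa using this.ne
    have hlam : lam i = (∫⁻ a, (a i : ENNReal) ∂ν).toReal := by
      rw [← hν.mean i, ← integral_toReal (Measurable.aemeasurable (by fun_prop))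
        (Eventually.of_forall fun _ => ENNReal.coe_lt_top)]
      rfl
    rw [hlam]
    refine (ENNReal.tendsto_toReal hfin).comp ?_
    refine lintegral_tendsto_of_tendsto_of_monotone
      (fun n => Measurable.aemeasurable (by fun_prop))
      (Eventually.of_forall fun a n k hnk => ?_) (Eventually.of_forall fun a => ?_)
    · have : (n : ℝ≥0) ≤ k := by exact_mod_cast hnk
      exact ENNReal.coe_le_coe.2 (min_le_min le_rfl this)
    · refine tendsto_atTop_of_eventually_const (i₀ := ⌈a i⌉₊) fun n hn => ?_
      rw [min_eq_left ((Nat.le_ceil _).trans (by exact_mod_cast hn))]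
  have hFlim : ∀ i, Tendsto (fun n : ℕ => (F i).real (Set.Iic (n : ℝ≥0))) atTop (𝓝 1) := by
    intro i
    have h1 : Tendsto (fun n : ℕ => F i (Set.Iic (n : ℝ≥0))) atTop
        (𝓝 (F i (⋃ n : ℕ, Set.Iic (n : ℝ≥0)))) :=
      tendsto_measure_iUnion_atTop fun n k hnk => Set.Iic_subset_Iic.2 (by exact_mod_cast hnk)
    have h2 : (⋃ n : ℕ, Set.Iic (n : ℝ≥0)) = Set.univ := by
      ext q
      simpa using exists_nat_ge q
    rw [h2, measure_univ] at h1
    exact (ENNReal.tendsto_toReal ENNReal.one_ne_top).comp h1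
  -- As `F i (Iic n) → 1` and `m i n → lam i`, one truncation level serves all the finitely many
  -- queues.
  have hK : ∀ᶠ n : ℕ in atTop, ∀ i, lam i - ε / 2 < (F i).real (Set.Iic (n : ℝ≥0)) * m i n := by
    refine eventually_all.2 fun i => ?_
    have := (hFlim i).mul (hm i)
    rw [one_mul] at this
    exact this.eventually (lt_mem_nhds (by linarith))
  obtain ⟨n, hn⟩ := hK.exists
  have hT : ∀ᶠ t in atTop, ∀ i,
      lam i - ε / 2 < (queueLaw P φ ν μ₀ t).real {x | x i ≤ n} * m i n :=
    eventually_all.2 fun i =>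
      ((hlim i n).mul_const (m i n)).eventually (lt_mem_nhds (hn i))
  obtain ⟨T₀, hT₀⟩ := eventually_atTop.1 hT
  let g : Fin N → ℕ → ℝ := fun i t =>
    (∫⁻ x, (min (x i) (2 * n) : ℝ≥0) ∂(queueLaw P φ ν μ₀ t)).toReal
  let s : ℕ → Fin N → ℝ := fun t i =>
    (∫⁻ x, ∫⁻ d, service i d ∂(decisionKernel P φ x) ∂(queueLaw P φ ν μ₀ t)).toReal
  have hg : ∀ i t, ∫⁻ x, (min (x i) (2 * n) : ℝ≥0) ∂(queueLaw P φ ν μ₀ t) ≤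
      ((2 * n : ℝ≥0) : ENNReal) := by
    intro i t
    calc _ ≤ ∫⁻ _, ((2 * n : ℝ≥0) : ENNReal) ∂(queueLaw P φ ν μ₀ t) :=
          lintegral_mono fun x => ENNReal.coe_le_coe.2 (min_le_right _ _)
      _ = _ := by simp
  have hg' : ∀ i t, g i t ≤ 2 * n := by
    intro i t
    exact (ENNReal.toReal_mono ENNReal.coe_ne_top (hg i t)).trans_eq (by simp)
  have hstep : ∀ i t, T₀ ≤ t → g i t + (lam i - ε / 2) ≤ g i (t + 1) + s t i := by
    intro i t ht
    have h1 := lintegral_truncated_le P φ ν (queueLaw P φ ν μ₀ t) i n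
    have h2 := ENNReal.toReal_mono (ENNReal.add_ne_top.2
      ⟨ne_top_of_le_ne_top ENNReal.coe_ne_top (hg i (t + 1)),
        lintegral_lintegral_service_ne_top P φ _ i⟩) h1
    have hmtop : ∫⁻ a, (min (a i) (n : ℝ≥0) : ℝ≥0) ∂ν ≠ ⊤ := by
      refine ne_top_of_le_ne_top (b := ((n : ℝ≥0) : ENNReal)) ENNReal.coe_ne_top ?_
      calc _ ≤ ∫⁻ _, ((n : ℝ≥0) : ENNReal) ∂ν :=
            lintegral_mono fun x => ENNReal.coe_le_coe.2 (min_le_right _ _)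
        _ = _ := by simp
    rw [ENNReal.toReal_add (ne_top_of_le_ne_top ENNReal.coe_ne_top (hg i t))
      (ENNReal.mul_ne_top (measure_ne_top _ _) hmtop), ENNReal.toReal_mul,
      ENNReal.toReal_add (ne_top_of_le_ne_top ENNReal.coe_ne_top (hg i (t + 1)))
        (lintegral_lintegral_service_ne_top P φ _ i)] at h2
    have h3 := hT₀ t ht i
    exact (add_le_add le_rfl h3.le).trans h2
  have hsum : ∀ i T, g i T₀ + T * (lam i - ε / 2) ≤
      g i (T₀ + T) + ∑ t ∈ Finset.range T, s (T₀ + t) i := by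
    intro i T
    induction T with
    | zero => simp
    | succ T ih =>
      have := hstep i (T₀ + T) (Nat.le_add_right _ _)
      rw [Finset.sum_range_succ, ← add_assoc T₀]
      push_cast
      linarith
  -- The telescoped drift leaves a boundary term of at most `2 * n`; over `T` slots it costs less
  -- than `ε / 2` per slot.
  obtain ⟨T, hT⟩ := exists_nat_gt (2 * (2 * n) / ε)
  have hTpos : (0 : ℝ) < T := lt_of_le_of_lt (by positivity) hT
  refine ⟨∑ t ∈ Finset.range T, (T : ℝ)⁻¹ • s (T₀ + t), ?_, fun i => ?_⟩
  · refine (convex_rateRegion P rstar).sum_mem (fun _ _ => by positivity) ?_ fun t _ =>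
      toReal_lintegral_service_mem_rateRegion hr φ _
    simp [hTpos.ne']
  · rw [← Finset.smul_sum, Pi.smul_apply, Finset.sum_apply, smul_eq_mul, ← div_eq_inv_mul,
      le_div_iff₀ hTpos]
    have h1 := hsum i T
    have h2 := hg' i (T₀ + T)
    have h3 : 0 ≤ g i T₀ := ENNReal.toReal_nonneg
    rw [div_lt_iff₀ hε] at hT
    linarith

theorem mem_rateRegion_of_queueStable {P : JointStatistics N S} {rstar : Fin N → S → S}
    (hr : IsOptimalRate P rstar) {φ : StationaryPolicy N S} {lam : Fin N → ℝ}
    {ν μ₀ : Measure (Fin N → ℝ≥0)} (hν : IsArrivalLaw ν lam) (hμ₀ : IsProbabilityMeasure μ₀)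
    (hstab : ∀ i, QueueStable (queueLaw P φ ν μ₀) i) : lam ∈ rateRegion P rstar := by
  have h0 : ∀ i, 0 ≤ lam i := fun i => by
    rw [← hν.mean i]
    exact integral_nonneg fun _ => NNReal.coe_nonneg _
  -- The cut at `0` is needed because the region has only nonnegative points.
  have hmem : ∀ ε : ℝ, 0 < ε → (fun i => max (lam i - ε) 0) ∈ rateRegion P rstar := by
    intro ε hε
    obtain ⟨v, hv, hle⟩ := exists_mem_rateRegion_sub_le hr hν hstab hε
    exact mem_rateRegion_of_le hv (fun i => le_max_right _ _)
      fun i => max_le (hle i) (nonneg_of_mem_rateRegion hv i)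
  refine (isClosed_rateRegion P rstar).mem_of_tendsto
    (f := fun ε : ℝ => fun i => max (lam i - ε) 0) (b := 𝓝[>] 0) ?_
    (eventually_nhdsWithin_of_forall hmem)
  refine tendsto_pi_nhds.2 fun i => ?_
  have hc : Continuous fun ε : ℝ => max (lam i - ε) 0 := by fun_prop
  have := hc.tendsto 0
  rw [sub_zero, max_eq_left (h0 i)] at this
  exact this.mono_left nhdsWithin_le_nhds

/-! ### Policies that ignore the queue lengths -/

/-- The distribution of a decision which schedules user `i` with probability `p i`, at the rate
`r i`. -/
def decisionLaw (p : Fin N → ℝ) (r : Fin N → S) : Measure (Fin N × S) :=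
  ∑ i, ENNReal.ofReal (p i) • Measure.dirac (i, r i)

theorem isProbabilityMeasure_decisionLaw {p : Fin N → ℝ} (hp : ∀ i, 0 ≤ p i) (h1 : ∑ i, p i = 1)
    (r : Fin N → S) : IsProbabilityMeasure (decisionLaw p r) := by
  constructor
  simp [decisionLaw, ← ENNReal.ofReal_sum_of_nonneg fun i _ => hp i, h1]

theorem decisionLaw_real_singleton {p : Fin N → ℝ} (hp : ∀ i, 0 ≤ p i) (r : Fin N → S)
    (i : Fin N) (s : S) : (decisionLaw p r).real {(i, s)} = if s = r i then p i else 0 := by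
  classical
  rw [Measure.real, decisionLaw, Measure.finsetSum_apply, Finset.sum_eq_single i]
  · by_cases h : s = r i
    · simp [h, hp i]
    · have h' : r i ≠ s := fun h'' => h h''.symm
      simp [h, h']
  · intro j _ hj
    simp [hj]
  · simp

/-- The policy that ignores the queue lengths, and schedules user `i` with probability
`p chat i` at the rate `rstar i (chat i)` when the estimates are `chat`. -/
def staticPolicy (p : (Fin N → S) → Fin N → ℝ) (hp : ∀ chat i, 0 ≤ p chat i)
    (h1 : ∀ chat, ∑ i, p chat i = 1) (rstar : Fin N → S → S) : StationaryPolicy N S where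
  kernel :=
    { toFun := fun z => decisionLaw (p z.2) fun i => rstar i (z.2 i)
      measurable' := (measurable_of_finite fun chat : Fin N → S =>
        decisionLaw (p chat) fun i => rstar i (chat i)).comp measurable_snd }
  isMarkov := ⟨fun z => isProbabilityMeasure_decisionLaw (hp z.2) (h1 z.2) _⟩

theorem decisionKernel_congr (P : JointStatistics N S) (φ : StationaryPolicy N S)
    (h : ∀ x y chat, φ.kernel (x, chat) = φ.kernel (y, chat)) (x y : Fin N → ℝ≥0) :
    decisionKernel P φ x = decisionKernel P φ y := by
  ext s hs
  simp only [decisionKernel, Kernel.compProd_apply hs, Kernel.const_apply, Kernel.comap_apply,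
    h x y]

/-- Every element of the rate region is dominated by the mean service vector of a policy that
ignores the queue lengths. -/
theorem exists_policy_le_integral_service (hN : 0 < N) {P : JointStatistics N S}
    {rstar : Fin N → S → S} {lam : Fin N → ℝ} (h : lam ∈ rateRegion P rstar) :
    ∃ φ : StationaryPolicy N S, (∀ x y, decisionKernel P φ x = decisionKernel P φ y) ∧
      ∀ x i, lam i ≤ ∫ d, (service i d : ℝ) ∂(decisionKernel P φ x) := by
  classical
  obtain ⟨p, hp, hp1, hlam⟩ := (mem_rateRegion_iff _ _ _).1 h
  -- A policy must always schedule someone, so the idle probability goes to an arbitrary user, whose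
  -- service can only grow.
  let i₀ : Fin N := ⟨0, hN⟩
  let p' : (Fin N → S) → Fin N → ℝ := fun chat i =>
    p chat i + if i = i₀ then 1 - ∑ j, p chat j else 0
  have hle : ∀ chat i, p chat i ≤ p' chat i := by
    intro chat i
    have := hp1 chat
    simp only [p']
    split_ifs <;> linarith
  have hp' : ∀ chat i, 0 ≤ p' chat i := fun chat i => (hp chat i).trans (hle chat i)
  have hsum : ∀ chat, ∑ i, p' chat i = 1 := by
    intro chat
    simp [p', Finset.sum_add_distrib]
  refine ⟨staticPolicy p' hp' hsum rstar, decisionKernel_congr P _ fun x y chat => rfl,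
    fun x i => ?_⟩
  rw [integral_service, hlam i]
  refine Finset.sum_le_sum fun chat _ =>
    mul_le_mul_of_nonneg_left ?_ (estimateProb_nonneg P chat)
  have : ∀ r, ((staticPolicy p' hp' hsum rstar).kernel (x, chat)).real {(i, r)} =
      if r = rstar i (chat i) then p' chat i else 0 :=
    fun r => decisionLaw_real_singleton (hp' chat) _ i r
  simp only [this, ite_mul, zero_mul, Finset.sum_ite_eq', Finset.mem_univ, if_true]
  exact mul_le_mul_of_nonneg_right (hle chat i) (expectedRate_nonneg _ _ _ _)

/-! ### Limit laws under such policies -/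

section Static

variable {P : JointStatistics N S} {φ : StationaryPolicy N S}

/-- The law of the randomness of one slot. -/
def slotLaw (P : JointStatistics N S) (φ : StationaryPolicy N S) (ν : Measure (Fin N → ℝ≥0)) :
    Measure (((Fin N → S × S) × (Fin N × S)) × (Fin N → ℝ≥0)) :=
  (decisionKernel P φ 0).prod ν

instance (P : JointStatistics N S) (φ : StationaryPolicy N S) (ν : Measure (Fin N → ℝ≥0))
    [IsProbabilityMeasure ν] : IsProbabilityMeasure (slotLaw P φ ν) := by
  unfold slotLaw; infer_instance

/-- The services offered in one slot. -/
def slotService (w : ((Fin N → S × S) × (Fin N × S)) × (Fin N → ℝ≥0)) (i : Fin N) : ℝ≥0 :=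
  service i w.1

/-- The arrivals of one slot. -/
def slotArrival (w : ((Fin N → S × S) × (Fin N × S)) × (Fin N → ℝ≥0)) (i : Fin N) : ℝ≥0 :=
  w.2 i

theorem measurable_slotService : Measurable (slotService (N := N) (S := S)) :=
  measurable_pi_lambda _ fun i => (measurable_service i).comp measurable_fst

theorem measurable_slotArrival : Measurable (slotArrival (N := N) (S := S)) :=
  measurable_snd

theorem bind_queueKernel (hφ : ∀ x y, decisionKernel P φ x = decisionKernel P φ y)
    (ν μ : Measure (Fin N → ℝ≥0)) [IsProbabilityMeasure ν] [SFinite μ] :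
    μ.bind (queueKernel P φ ν) =
      (μ.prod (slotLaw P φ ν)).map (recursionStep slotService slotArrival) := by
  have hm : Measurable (recursionStep (slotService (N := N) (S := S)) slotArrival) :=
    measurable_recursionStep measurable_slotService measurable_slotArrival
  ext s hs
  rw [Measure.bind_apply hs (Kernel.aemeasurable _), Measure.map_apply hm hs,
    Measure.prod_apply (hm hs)]
  refine lintegral_congr fun x => ?_
  have hw : Measurable fun w : ((Fin N → S × S) × (Fin N × S)) × (Fin N → ℝ≥0) =>
      nextQueue (x, w) := measurable_nextQueue.comp measurable_prodMk_left
  rw [queueKernel_apply, Measure.map_apply hw hs, hφ x 0]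
  rfl

theorem queueLaw_eq_map_backward (hφ : ∀ x y, decisionKernel P φ x = decisionKernel P φ y)
    (ν μ₀ : Measure (Fin N → ℝ≥0)) [IsProbabilityMeasure ν] [IsProbabilityMeasure μ₀] (t : ℕ) :
    queueLaw P φ ν μ₀ t = (μ₀.prod (Measure.infinitePi fun _ => slotLaw P φ ν)).map
      (backward slotService slotArrival t) := by
  induction t with
  | zero =>
    change μ₀ = (μ₀.prod (Measure.infinitePi fun _ => slotLaw P φ ν)).map Prod.fst
    simp
  | succ t ih =>
    rw [map_backward_succ _ measurable_slotService measurable_slotArrival, ← ih, queueLaw]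
    have := isProbabilityMeasure_queueLaw P φ ν μ₀ t
    exact bind_queueKernel hφ ν _

theorem measurePreserving_fst_slotLaw (ν : Measure (Fin N → ℝ≥0)) [IsProbabilityMeasure ν] :
    MeasurePreserving Prod.fst (slotLaw P φ ν) (decisionKernel P φ 0) :=
  measurePreserving_fst

theorem measurePreserving_snd_slotLaw (ν : Measure (Fin N → ℝ≥0)) [IsProbabilityMeasure ν] :
    MeasurePreserving Prod.snd (slotLaw P φ ν) ν :=
  measurePreserving_snd

theorem integrable_service (x : Fin N → ℝ≥0) (i : Fin N) :
    Integrable (fun d => (service i d : ℝ)) (decisionKernel P φ x) :=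
  Integrable.of_finite

theorem integrable_slotService (ν : Measure (Fin N → ℝ≥0)) [IsProbabilityMeasure ν] (i : Fin N) :
    Integrable (fun w => (slotService w i : ℝ)) (slotLaw P φ ν) :=
  (measurePreserving_fst_slotLaw ν).integrable_comp_of_integrable (integrable_service 0 i)

theorem integral_slotService (ν : Measure (Fin N → ℝ≥0)) [IsProbabilityMeasure ν] (i : Fin N) :
    ∫ w, (slotService w i : ℝ) ∂(slotLaw P φ ν) =
      ∫ d, (service i d : ℝ) ∂(decisionKernel P φ 0) := by
  rw [← (measurePreserving_fst_slotLaw (P := P) (φ := φ) ν).map_eq,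
    integral_map measurable_fst.aemeasurable
      (measurable_service i).coe_nnreal_real.aestronglyMeasurable]
  rfl

theorem integral_slotArrival {ν : Measure (Fin N → ℝ≥0)} [IsProbabilityMeasure ν]
    (i : Fin N) :
    ∫ w, (slotArrival w i : ℝ) ∂(slotLaw P φ ν) = ∫ a, (a i : ℝ) ∂ν := by
  conv_rhs => rw [← (measurePreserving_snd_slotLaw (P := P) (φ := φ) ν).map_eq]
  rw [integral_map measurable_snd.aemeasurable
      (measurable_pi_apply i).coe_nnreal_real.aestronglyMeasurable]
  rfl

theorem integrable_slotArrival {ν : Measure (Fin N → ℝ≥0)} {lam : Fin N → ℝ}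
    (hν : IsArrivalLaw ν lam) (i : Fin N) :
    Integrable (fun w => (slotArrival w i : ℝ)) (slotLaw P φ ν) :=
  have := hν.isProb
  (measurePreserving_snd_slotLaw ν).integrable_comp_of_integrable (hν.integrable i)

theorem ae_tendsto_netInput_slot {ν : Measure (Fin N → ℝ≥0)} {lam : Fin N → ℝ}
    (hν : IsArrivalLaw ν lam) {i : Fin N}
    (hi : lam i < ∫ d, (service i d : ℝ) ∂(decisionKernel P φ 0)) :
    ∀ᵐ ω ∂(Measure.infinitePi fun _ : ℕ => slotLaw P φ ν),
      Tendsto (netInput (fun n => slotService (ω n) i) (fun n => slotArrival (ω n) i))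
        atTop atBot := by
  have := hν.isProb
  refine ae_tendsto_netInput _ i measurable_slotService measurable_slotArrival
    (integrable_slotService ν i) (integrable_slotArrival hν i) ?_
  rw [integral_slotArrival, integral_slotService, hν.mean i]
  exact hi

/-- The law of the vector of limits of the backward iterates. -/
def limitLaw (P : JointStatistics N S) (φ : StationaryPolicy N S) (ν : Measure (Fin N → ℝ≥0)) :
    Measure (Fin N → ℝ≥0) :=
  (Measure.infinitePi fun _ : ℕ => slotLaw P φ ν).map (loynesVector slotService slotArrival)

theorem isProbabilityMeasure_limitLaw (ν : Measure (Fin N → ℝ≥0)) [IsProbabilityMeasure ν] :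
    IsProbabilityMeasure (limitLaw P φ ν) :=
  Measure.isProbabilityMeasure_map
    (measurable_loynesVector measurable_slotService measurable_slotArrival).aemeasurable

theorem tendsto_queueLaw (hφ : ∀ x y, decisionKernel P φ x = decisionKernel P φ y)
    {ν : Measure (Fin N → ℝ≥0)} {lam : Fin N → ℝ} (hν : IsArrivalLaw ν lam) {i : Fin N}
    (hi : lam i < ∫ d, (service i d : ℝ) ∂(decisionKernel P φ 0))
    (μ₀ : Measure (Fin N → ℝ≥0)) [IsProbabilityMeasure μ₀] (q : ℝ≥0) :
    Tendsto (fun t => (queueLaw P φ ν μ₀ t).real {x | x i ≤ q}) atTop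
      (𝓝 ((limitLaw P φ ν).real {x | x i ≤ q})) := by
  have := hν.isProb
  simp only [queueLaw_eq_map_backward hφ]
  exact tendsto_measure_backward _ i measurable_slotService measurable_slotArrival
    (fun w => service_le i w.1) (ae_tendsto_netInput_slot hν hi) μ₀ q

theorem invariant_limitLaw (hφ : ∀ x y, decisionKernel P φ x = decisionKernel P φ y)
    {ν : Measure (Fin N → ℝ≥0)} {lam : Fin N → ℝ} (hν : IsArrivalLaw ν lam)
    (h : ∀ i, lam i < ∫ d, (service i d : ℝ) ∂(decisionKernel P φ 0)) :
    Kernel.Invariant (queueKernel P φ ν) (limitLaw P φ ν) := by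
  have := hν.isProb
  have := isProbabilityMeasure_limitLaw (P := P) (φ := φ) ν
  rw [Kernel.Invariant, bind_queueKernel hφ]
  exact map_loynesVector_eq _ measurable_slotService measurable_slotArrival
    (fun w i => service_le i w.1) fun i => ae_tendsto_netInput_slot hν (h i)

/-- Nonnegative variables of mean zero vanish almost surely, so this queue is frozen at its initial
content. This handles coordinates in which a boundary point has no slack. -/
theorem queueLaw_real_eq_of_zero (hφ : ∀ x y, decisionKernel P φ x = decisionKernel P φ y)
    {ν : Measure (Fin N → ℝ≥0)} {lam : Fin N → ℝ} (hν : IsArrivalLaw ν lam) {i : Fin N}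
    (hi : lam i = 0) (hs : ∫ d, (service i d : ℝ) ∂(decisionKernel P φ 0) = 0)
    (μ₀ : Measure (Fin N → ℝ≥0)) [IsProbabilityMeasure μ₀] (t : ℕ) (q : ℝ≥0) :
    (queueLaw P φ ν μ₀ t).real {x | x i ≤ q} = μ₀.real {x | x i ≤ q} := by
  have := hν.isProb
  have hset : MeasurableSet {x : Fin N → ℝ≥0 | x i ≤ q} :=
    measurableSet_le (measurable_pi_apply i) measurable_const
  have h1 : ∀ᵐ w ∂(slotLaw P φ ν), slotService w i = 0 ∧ slotArrival w i = 0 := by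
    have ha := (integral_eq_zero_iff_of_nonneg (fun w => NNReal.coe_nonneg (slotService w i))
      (integrable_slotService (P := P) (φ := φ) ν i)).1 ((integral_slotService ν i).trans hs)
    have hb := (integral_eq_zero_iff_of_nonneg (fun w => NNReal.coe_nonneg (slotArrival w i))
      (integrable_slotArrival (P := P) (φ := φ) hν i)).1
      ((integral_slotArrival i).trans ((hν.mean i).trans hi))
    filter_upwards [ha, hb] with w hwa hwb
    exact ⟨NNReal.coe_eq_zero.1 hwa, NNReal.coe_eq_zero.1 hwb⟩
  have h2 : ∀ᵐ ω ∂(Measure.infinitePi fun _ : ℕ => slotLaw P φ ν),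
      ∀ n, slotService (ω n) i = 0 ∧ slotArrival (ω n) i = 0 :=
    ae_all_iff.2 fun n =>
      (measurePreserving_eval_infinitePi (fun _ : ℕ => slotLaw P φ ν) n).quasiMeasurePreserving.ae
        h1
  have h3 : ∀ᵐ z ∂(μ₀.prod (Measure.infinitePi fun _ : ℕ => slotLaw P φ ν)),
      ∀ n, slotService (z.2 n) i = 0 ∧ slotArrival (z.2 n) i = 0 :=
    Measure.quasiMeasurePreserving_snd.ae h2
  have hfst : (μ₀.prod (Measure.infinitePi fun _ : ℕ => slotLaw P φ ν)).map Prod.fst = μ₀ := by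
    simp
  rw [queueLaw_eq_map_backward hφ]
  conv_rhs => rw [← hfst]
  rw [Measure.real, Measure.real, Measure.map_apply (measurable_backward measurable_slotService
    measurable_slotArrival t) hset, Measure.map_apply measurable_fst hset]
  congr 1
  refine measure_congr ?_
  filter_upwards [h3] with z hz
  refine propext ?_
  change lindley t (z.1 i) _ _ ≤ q ↔ z.1 i ≤ q
  rw [lindley_zero_input t (z.1 i) (fun n => (hz n).1) (fun n => (hz n).2)]

theorem supports_of_lt_or_eq_zero (hφ : ∀ x y, decisionKernel P φ x = decisionKernel P φ y)
    {lam : Fin N → ℝ}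
    (h : ∀ i, lam i < ∫ d, (service i d : ℝ) ∂(decisionKernel P φ 0) ∨
      lam i = 0 ∧ ∫ d, (service i d : ℝ) ∂(decisionKernel P φ 0) = 0) :
    Supports P φ lam := by
  intro ν μ₀ hν hμ₀ i
  have := hν.isProb
  have := isProbabilityMeasure_limitLaw (P := P) (φ := φ) ν
  have hmap : ∀ (μ : Measure (Fin N → ℝ≥0)) (q : ℝ≥0),
      (μ.map fun x => x i).real (Set.Iic q) = μ.real {x | x i ≤ q} := fun μ q => by
    rw [Measure.real, Measure.map_apply (measurable_pi_apply i) measurableSet_Iic]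
    rfl
  rcases h i with hi | ⟨hi, hs⟩
  · refine ⟨(limitLaw P φ ν).map fun x => x i,
      Measure.isProbabilityMeasure_map (measurable_pi_apply i).aemeasurable, fun q => ?_⟩
    rw [hmap]
    exact tendsto_queueLaw hφ hν hi μ₀ q
  -- Stability allows the limit law to depend on the initial law.
  · refine ⟨μ₀.map fun x => x i,
      Measure.isProbabilityMeasure_map (measurable_pi_apply i).aemeasurable, fun q => ?_⟩
    rw [hmap]
    simp only [queueLaw_real_eq_of_zero hφ hν hi hs]
    exact tendsto_const_nhds

end Static

/-! ### The stability region -/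

theorem isArrivalLaw_dirac {lam : Fin N → ℝ} (h : 0 ≤ lam) :
    IsArrivalLaw (Measure.dirac fun i => (lam i).toNNReal) lam where
  isProb := inferInstance
  integrable i := by
    refine (integrable_dirac' ?_ ?_)
    · exact (measurable_pi_apply i).coe_nnreal_real.stronglyMeasurable
    · simp
  mean i := by
    rw [integral_dirac' _ _ (measurable_pi_apply i).coe_nnreal_real.stronglyMeasurable]
    exact Real.coe_toNNReal _ (h i)

/-- Scaling towards `0` works even when the region has empty interior, as when some user can never
be served: positive coordinates gain strict slack, and a zero coordinate has either positive mean
service or none at all. -/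
theorem exists_supports_smul (hN : 0 < N) {P : JointStatistics N S} {rstar : Fin N → S → S}
    {lam : Fin N → ℝ} (h : lam ∈ rateRegion P rstar) {θ : ℝ} (hθ : θ < 1) :
    ∃ φ : StationaryPolicy N S, Supports P φ (θ • lam) := by
  obtain ⟨φ, hφ, hle⟩ := exists_policy_le_integral_service hN h
  refine ⟨φ, supports_of_lt_or_eq_zero hφ fun i => ?_⟩
  have h0 : 0 ≤ lam i := nonneg_of_mem_rateRegion h i
  have h1 := hle 0 i
  rw [Pi.smul_apply, smul_eq_mul]
  rcases h0.eq_or_lt with h0 | h0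
  · rw [← h0, mul_zero]
    rw [← h0] at h1
    rcases h1.eq_or_lt with h1 | h1
    · exact Or.inr ⟨rfl, h1.symm⟩
    · exact Or.inl h1
  · left
    nlinarith

theorem stabilityRegion_eq_rateRegion (hN : 0 < N) {P : JointStatistics N S}
    {rstar : Fin N → S → S} (hr : IsOptimalRate P rstar) :
    stabilityRegion P = rateRegion P rstar := by
  apply Set.Subset.antisymm
  · refine closure_minimal ?_ (isClosed_rateRegion P rstar)
    rintro lam ⟨h0, φ, hφ⟩
    have hν := isArrivalLaw_dirac h0
    have hμ₀ : IsProbabilityMeasure (Measure.dirac (0 : Fin N → ℝ≥0)) := inferInstance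
    exact mem_rateRegion_of_queueStable hr hν hμ₀ (hφ _ _ hν hμ₀)
  · intro lam h
    have hc : Tendsto (fun θ : ℝ => θ • lam) (𝓝[<] 1) (𝓝 lam) := by
      have : Continuous fun θ : ℝ => θ • lam := by fun_prop
      have := this.tendsto 1
      rw [one_smul] at this
      exact this.mono_left nhdsWithin_le_nhds
    refine mem_closure_of_tendsto hc ?_
    filter_upwards [self_mem_nhdsWithin,
      mem_nhdsWithin_of_mem_nhds (lt_mem_nhds (zero_lt_one (α := ℝ)))] with θ hθ1 hθ0
    exact ⟨smul_nonneg (le_of_lt hθ0) (nonneg_of_mem_rateRegion h), exists_supports_smul hN h hθ1⟩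

theorem exists_pos_add_mem_of_mem_interior {s : Set (Fin N → ℝ)} {lam : Fin N → ℝ}
    (h : lam ∈ interior s) : ∃ ε > 0, (fun i => lam i + ε) ∈ s := by
  have hc : Tendsto (fun ε : ℝ => fun i => lam i + ε) (𝓝[>] 0) (𝓝 lam) := by
    have : Continuous fun ε : ℝ => fun i => lam i + ε := by fun_prop
    have := this.tendsto 0
    simp only [add_zero] at this
    exact this.mono_left nhdsWithin_le_nhds
  obtain ⟨ε, h1, h2⟩ := ((hc.eventually (mem_interior_iff_mem_nhds.1 h)).and
    self_mem_nhdsWithin).exists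
  exact ⟨ε, h2, h1⟩

end Downlink

end

theorem proposition1 {N : ℕ} (hN : 0 < N) {S : Finset ℝ≥0} (P : Downlink.JointStatistics N S)
    (rstar : Fin N → S → S) (hr : Downlink.IsOptimalRate P rstar) :
    Downlink.stabilityRegion P = Downlink.rateRegion P rstar ∧
    (∀ lam ∈ interior (Downlink.rateRegion P rstar),
      ∃ φ : Downlink.StationaryPolicy N S, Downlink.Supports P φ lam ∧
        ∀ ν : Measure (Fin N → ℝ≥0), Downlink.IsArrivalLaw ν lam →
          ∃ π : Measure (Fin N → ℝ≥0), IsProbabilityMeasure π ∧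
            Kernel.Invariant (Downlink.queueKernel P φ ν) π ∧
            ∀ μ₀ : Measure (Fin N → ℝ≥0), IsProbabilityMeasure μ₀ → ∀ (i : Fin N) (q : ℝ≥0),
              Tendsto (fun t => (Downlink.queueLaw P φ ν μ₀ t).real {x | x i ≤ q}) atTop
                (𝓝 (π.real {x | x i ≤ q}))) ∧
    (∀ lam : Fin N → ℝ, lam ∉ Downlink.rateRegion P rstar →
      ∀ (φ : Downlink.StationaryPolicy N S) (ν μ₀ : Measure (Fin N → ℝ≥0)),
        Downlink.IsArrivalLaw ν lam → IsProbabilityMeasure μ₀ →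
          ¬ ∀ i, Downlink.QueueStable (Downlink.queueLaw P φ ν μ₀) i) := by
  refine ⟨Downlink.stabilityRegion_eq_rateRegion hN hr, fun lam hlam => ?_,
    fun lam hlam φ ν μ₀ hν hμ₀ hstab =>
      hlam (Downlink.mem_rateRegion_of_queueStable hr hν hμ₀ hstab)⟩
  -- Slack in every coordinate excludes frozen queues, so a single invariant law provides the limits
  -- for all initial laws.
  obtain ⟨ε, hε, hmem⟩ := Downlink.exists_pos_add_mem_of_mem_interior hlam
  obtain ⟨φ, hφ, hle⟩ := Downlink.exists_policy_le_integral_service hN hmem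
  have hlt : ∀ i, lam i <
      ∫ d, (Downlink.service i d : ℝ) ∂(Downlink.decisionKernel P φ 0) := fun i =>
    lt_of_lt_of_le (lt_add_of_pos_right _ hε) (hle 0 i)
  refine ⟨φ, Downlink.supports_of_lt_or_eq_zero hφ fun i => Or.inl (hlt i), fun ν hν => ?_⟩
  have := hν.isProb
  exact ⟨Downlink.limitLaw P φ ν, Downlink.isProbabilityMeasure_limitLaw ν,
    Downlink.invariant_limitLaw hφ hν hlt,
    fun μ₀ hμ₀ i q => Downlink.tendsto_queueLaw hφ hν (hlt i) μ₀ q⟩
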